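/- Let $p$ be a prime. For a profinite group $\Gamma$ acting trivially on $\mathbb Z/p$ let $C^r(\Gamma)$ be the group of continuous inhomogeneous cochains $\Gamma^r\to\mathbb Z/p$, with coboundary $\partial$ and cup product $\cup$, and let $H^r(\Gamma)=H^r(\Gamma,\mathbb Z/p)$ be its cohomology; thus $H^1(\Gamma)$ is the group of continuous homomorphisms $\Gamma\to\mathbb Z/p$. For $\chi_1,\chi_2,\chi_3\in H^1(\Gamma)$ the triple Massey product $\langle\chi_1,\chi_2,\chi_3\rangle\subseteq H^2(\Gamma)$ is the set of all classes $[\chi_1\cup c_{23}+c_{12}\cup\chi_3]$ with $c_{12},c_{23}\in C^1(\Gamma)$, $\partial c_{12}=\chi_1\cup\chi_2$ and $\partial c_{23}=\chi_2\cup\chi_3$; it is called essential if it is non-empty but does not contain $0$. A $p$-Kummer formation $(G,A,\{\kappa_U\}_U)$ consists of a profinite group $G$, a discrete $G$-module $A$, and for each open normal subgroup $U$ of $G$ a $G$-equivariant surjective homomorphism $\kappa_U\colon A^U\to H^1(U)$, where $G$ acts on $H^1(U)$ by $(\sigma\varphi)(\tau)=\varphi(\sigma^{-1}\tau\sigma)$,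 such that for every open normal subgroup $U$ of $G$: (i) for every $\chi\in H^1(U)$ the sequence $$H^1(\operatorname{Ker}\chi)\xrightarrow{\operatorname{Cor}}H^1(U)\xrightarrow{\chi\cup}H^2(U)\xrightarrow{\operatorname{Res}}H^2(\operatorname{Ker}\chi)$$ is exact; (ii) $\operatorname{Ker}(\kappa_U)=pA^U$; (iii) for every open normal subgroup $U'$ of $G$ with $U\le U'$ one has $\kappa_U(a)=\operatorname{Res}_U\kappa_{U'}(a)$ for $a\in A^{U'}$, and $\kappa_{U'}(N_{U'/U}a)=\operatorname{Cor}_{U'}\kappa_U(a)$ for $a\in A^U$, where $N_{U'/U}a=\sum_{\sigma\in U'/U}\sigma a$; (iv) for every open normal subgroup $U'$ of $G$ with $U\le U'$ and $(U':U)=p$ one has $\hat H^{-1}(U'/U,A^U)=0$, where $\hat H^{-1}(U'/U,A^U)=\operatorname{Ker}(N_{U'/U})/I_{U'/U}$ and $I_{U'/U}\le A^U$ is the subgroup generated by all $\sigma a-a$ with $\sigma\in U'$, $a\in A^U$. **Theorem 5.4 (Main Theorem for formations).** Let $(G,A,\{\kappa_U\}_U)$ be a $p$-Kummer formation and let $\chi_1,\chi_2,\chi_3\in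 H^1(G)$. Then the triple Massey product $\langle\chi_1,\chi_2,\chi_3\rangle$ is not essential. -/

import Mathlib

noncomputable section

namespace KummerFormation

/-! ### Continuous cochains with values in `ℤ/p` (trivial action), in low degrees -/

section Cochains

variable (p : ℕ) (Γ : Type*) [Group Γ] [TopologicalSpace Γ]

/-- Continuous inhomogeneous `1`-cochains `Γ → ℤ/p`. -/
abbrev C1 : Type _ := C(Γ, ZMod p)

/-- Continuous inhomogeneous `2`-cochains `Γ × Γ → ℤ/p`. -/
abbrev C2 : Type _ := C(Γ × Γ, ZMod p)

/-- Continuous inhomogeneous `3`-cochains `Γ × Γ × Γ → ℤ/p`. -/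
abbrev C3 : Type _ := C(Γ × Γ × Γ, ZMod p)

variable [IsTopologicalGroup Γ]

/-- The differential `C¹ → C²`, `(∂φ)(σ, τ) = φ(τ) - φ(στ) + φ(σ)`. -/
def d1 : C1 p Γ →ₗ[ZMod p] C2 p Γ where
  toFun φ := ⟨fun x => φ x.2 - φ (x.1 * x.2) + φ x.1, by fun_prop⟩
  map_add' φ ψ := by ext x; simp; ring
  map_smul' a φ := by ext x; simp; ring

/-- The differential `C² → C³`,
`(∂f)(σ, τ, ρ) = f(τ, ρ) - f(στ, ρ) + f(σ, τρ) - f(σ, τ)`. -/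
def d2 : C2 p Γ →ₗ[ZMod p] C3 p Γ where
  toFun f := ⟨fun x => f (x.2.1, x.2.2) - f (x.1 * x.2.1, x.2.2) + f (x.1, x.2.1 * x.2.2)
    - f (x.1, x.2.1), by fun_prop⟩
  map_add' φ ψ := by ext x; simp; ring
  map_smul' a φ := by ext x; simp; ring

/-- Continuous `2`-cocycles. -/
def Z2 : Submodule (ZMod p) (C2 p Γ) := LinearMap.ker (d2 p Γ)

/-- `2`-coboundaries of continuous `1`-cochains. -/
def B2 : Submodule (ZMod p) (C2 p Γ) := LinearMap.range (d1 p Γ)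

/-- `H¹(Γ) = H¹(Γ, ℤ/p)`. As `Γ` acts trivially on `ℤ/p`, there are no nonzero `1`-coboundaries,
so `H¹(Γ)` is the group of continuous `1`-cocycles, i.e. of continuous homomorphisms
`Γ → ℤ/p`. -/
abbrev H1 : Submodule (ZMod p) (C1 p Γ) := LinearMap.ker (d1 p Γ)

/-- `H²(Γ) = H²(Γ, ℤ/p) = Z² / B²` (continuous cochain cohomology). -/
abbrev H2 : Type _ := Z2 p Γ ⧸ (B2 p Γ).submoduleOf (Z2 p Γ)

variable {p Γ}

/-- The class in `H²(Γ)` of a `2`-cocycle. -/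
def H2.mk (z : C2 p Γ) (hz : z ∈ Z2 p Γ) : H2 p Γ :=
  Submodule.Quotient.mk ⟨z, hz⟩

/-- The cup product `C¹ × C¹ → C²`, `(φ ∪ ψ)(σ, τ) = φ(σ) ψ(τ)`. -/
def cup (φ ψ : C1 p Γ) : C2 p Γ := ⟨fun x => φ x.1 * ψ x.2, by fun_prop⟩

theorem mem_H1_iff {φ : C1 p Γ} : φ ∈ H1 p Γ ↔ ∀ σ τ, φ (σ * τ) = φ σ + φ τ := by
  rw [LinearMap.mem_ker, ContinuousMap.ext_iff]
  constructor
  · intro h σ τ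
    have := h (σ, τ)
    simp only [d1, LinearMap.coe_mk, AddHom.coe_mk, ContinuousMap.coe_mk,
      ContinuousMap.zero_apply] at this
    linear_combination -this
  · rintro h ⟨σ, τ⟩
    simp [d1, h σ τ]

theorem H1.map_mul (χ : H1 p Γ) (σ τ : Γ) :
    (χ : C1 p Γ) (σ * τ) = (χ : C1 p Γ) σ + (χ : C1 p Γ) τ := mem_H1_iff.1 χ.2 σ τ

/-- An element of `H¹(Γ)` as a homomorphism `Γ → ℤ/p`. -/
def H1.toMonoidHom (χ : H1 p Γ) : Γ →* Multiplicative (ZMod p) :=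
  MonoidHom.mk' (fun σ => Multiplicative.ofAdd ((χ : C1 p Γ) σ)) fun σ τ => by
    rw [H1.map_mul, ofAdd_add]

/-- The kernel of `χ ∈ H¹(Γ)`, i.e. `{σ ∈ Γ | χ(σ) = 0}`. -/
def H1.ker (χ : H1 p Γ) : Subgroup Γ := (H1.toMonoidHom χ).ker

theorem H1.mem_ker {χ : H1 p Γ} {σ : Γ} : σ ∈ H1.ker χ ↔ (χ : C1 p Γ) σ = 0 := by
  rw [H1.ker, MonoidHom.mem_ker]
  exact Iff.rfl

theorem H1.isOpen_ker (χ : H1 p Γ) : IsOpen (H1.ker χ : Set Γ) := by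
  have : (H1.ker χ : Set Γ) = (χ : C1 p Γ) ⁻¹' {0} := by
    ext σ
    simp [H1.mem_ker]
  rw [this]
  exact (isOpen_discrete _).preimage (χ : C1 p Γ).continuous

instance H1.finiteIndex_ker [NeZero p] (χ : H1 p Γ) : (H1.ker χ).FiniteIndex := by
  have : Finite (Multiplicative (ZMod p)) := inferInstanceAs (Finite (ZMod p))
  exact Subgroup.finiteIndex_ker _

theorem cup_mem_Z2 (χ ψ : H1 p Γ) : cup (χ : C1 p Γ) (ψ : C1 p Γ) ∈ Z2 p Γ := by
  rw [Z2, LinearMap.mem_ker]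
  ext ⟨σ, τ, ρ⟩
  simp only [d2, cup, LinearMap.coe_mk, AddHom.coe_mk, ContinuousMap.coe_mk,
    ContinuousMap.zero_apply, H1.map_mul]
  ring

/-- The cup product `χ ∪ · : H¹(Γ) → H²(Γ)`. -/
def cupH (χ : H1 p Γ) : H1 p Γ →+ H2 p Γ where
  toFun ψ := H2.mk (cup (χ : C1 p Γ) (ψ : C1 p Γ)) (cup_mem_Z2 χ ψ)
  map_zero' := by
    have : cup (χ : C1 p Γ) ((0 : H1 p Γ) : C1 p Γ) = 0 := by ext x; simp [cup]
    simp only [this]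
    rfl
  map_add' ψ ψ' := by
    have : cup (χ : C1 p Γ) ((ψ + ψ' : H1 p Γ) : C1 p Γ)
        = cup (χ : C1 p Γ) (ψ : C1 p Γ) + cup (χ : C1 p Γ) (ψ' : C1 p Γ) := by
      ext x; simp [cup, mul_add]
    simp only [this]
    rfl

/-! ### Triple Massey products -/

theorem massey_mem_Z2 {χ₁ χ₂ χ₃ : H1 p Γ} {c₁₂ c₂₃ : C1 p Γ}
    (h₁₂ : d1 p Γ c₁₂ = cup (χ₁ : C1 p Γ) (χ₂ : C1 p Γ))
    (h₂₃ : d1 p Γ c₂₃ = cup (χ₂ : C1 p Γ) (χ₃ : C1 p Γ)) :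
    cup (χ₁ : C1 p Γ) c₂₃ + cup c₁₂ (χ₃ : C1 p Γ) ∈ Z2 p Γ := by
  rw [Z2, LinearMap.mem_ker]
  ext ⟨σ, τ, ρ⟩
  have h1 := DFunLike.congr_fun h₁₂ (σ, τ)
  have h2 := DFunLike.congr_fun h₂₃ (τ, ρ)
  simp only [d1, d2, cup, LinearMap.coe_mk, AddHom.coe_mk, ContinuousMap.coe_mk,
    ContinuousMap.zero_apply, ContinuousMap.add_apply, H1.map_mul] at h1 h2 ⊢
  linear_combination (χ₃ : C1 p Γ) ρ * h1 - (χ₁ : C1 p Γ) σ * h2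

/-- The triple Massey product `⟨χ₁, χ₂, χ₃⟩ ⊆ H²(Γ)`: the set of all classes
`[c₁₁ ∪ c₂₃ + c₁₂ ∪ c₃₃]`, where `(cᵢⱼ)` runs through the defining systems of size `3` with
`cᵢᵢ = χᵢ`, i.e. `∂c₁₂ = c₁₁ ∪ c₂₂` and `∂c₂₃ = c₂₂ ∪ c₃₃`. -/
def massey (χ₁ χ₂ χ₃ : H1 p Γ) : Set (H2 p Γ) :=
  {α | ∃ (c₁₂ c₂₃ : C1 p Γ) (h₁₂ : d1 p Γ c₁₂ = cup (χ₁ : C1 p Γ) (χ₂ : C1 p Γ))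
    (h₂₃ : d1 p Γ c₂₃ = cup (χ₂ : C1 p Γ) (χ₃ : C1 p Γ)),
    α = H2.mk (cup (χ₁ : C1 p Γ) c₂₃ + cup c₁₂ (χ₃ : C1 p Γ)) (massey_mem_Z2 h₁₂ h₂₃)}

/-- A subset of `H²(Γ)` (such as a Massey product) is essential if it is non-empty but does not
contain `0`. -/
def IsEssential (S : Set (H2 p Γ)) : Prop := S.Nonempty ∧ (0 : H2 p Γ) ∉ S

end Cochains

/-! ### Restriction and corestriction -/

section ResCor

variable {p : ℕ} {Γ Δ : Type*} [Group Γ] [TopologicalSpace Γ] [IsTopologicalGroup Γ]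
  [Group Δ] [TopologicalSpace Δ] [IsTopologicalGroup Δ]

/-- Pullback of `1`-cochain classes along a continuous homomorphism. -/
def pullH1 (f : Δ →ₜ* Γ) : H1 p Γ →+ H1 p Δ where
  toFun φ := ⟨(φ : C1 p Γ).comp ⟨f, f.continuous_toFun⟩, mem_H1_iff.2 fun σ τ => by
    simp [H1.map_mul]⟩
  map_zero' := rfl
  map_add' _ _ := rfl

/-- Pullback of `2`-cochains along a continuous homomorphism. -/
def pullC2 (f : Δ →ₜ* Γ) : C2 p Γ →ₗ[ZMod p] C2 p Δ where
  toFun z := z.comp ⟨fun x => (f x.1, f x.2),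
    (f.continuous_toFun.comp continuous_fst).prodMk (f.continuous_toFun.comp continuous_snd)⟩
  map_add' _ _ := rfl
  map_smul' _ _ := rfl

theorem pullC2_mem_Z2 (f : Δ →ₜ* Γ) {z : C2 p Γ} (hz : z ∈ Z2 p Γ) :
    pullC2 f z ∈ Z2 p Δ := by
  rw [Z2, LinearMap.mem_ker] at hz ⊢
  ext ⟨σ, τ, ρ⟩
  have := DFunLike.congr_fun hz (f σ, f τ, f ρ)
  simpa [d2, pullC2] using this

theorem pullC2_mem_B2 (f : Δ →ₜ* Γ) {z : C2 p Γ} (hz : z ∈ B2 p Γ) :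
    pullC2 f z ∈ B2 p Δ := by
  obtain ⟨φ, rfl⟩ := hz
  refine ⟨φ.comp ⟨f, f.continuous_toFun⟩, ?_⟩
  ext ⟨σ, τ⟩
  simp [d1, pullC2]

/-- Pullback `H²(Γ) → H²(Δ)` along a continuous homomorphism `Δ → Γ`. -/
def pullH2 (f : Δ →ₜ* Γ) : H2 p Γ →ₗ[ZMod p] H2 p Δ :=
  Submodule.mapQ _ _ ((pullC2 f).restrict fun _ hz => pullC2_mem_Z2 f hz)
    fun _ hz => pullC2_mem_B2 f hz

/-- The inclusion of a subgroup, as a continuous homomorphism. -/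
def incl (V : Subgroup Γ) : V →ₜ* Γ := ⟨V.subtype, continuous_subtype_val⟩

/-- The inclusion between two subgroups, as a continuous homomorphism. -/
def inclOfLE {V W : Subgroup Γ} (h : V ≤ W) : V →ₜ* W :=
  ⟨Subgroup.inclusion h, continuous_inclusion h⟩

open Subgroup.leftTransversals in
theorem continuous_transfer (V : Subgroup Γ) [V.FiniteIndex] (hV : IsOpen (V : Set Γ))
    (φ : H1 p V) :
    Continuous fun g : Γ => Multiplicative.toAdd (MonoidHom.transfer (H1.toMonoidHom φ) g) := by
  let T : V.LeftTransversal := default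
  let t : Γ ⧸ V → Γ := fun q => T.2.leftQuotientEquiv q
  have ht : ∀ q, (t q : Γ ⧸ V) = q := fun q => T.2.leftQuotientEquiv.symm_apply_apply q
  let K : Subgroup Γ := (H1.ker φ).map V.subtype
  have hK : IsOpen (K : Set Γ) := by
    have := hV.isOpenEmbedding_subtypeVal.isOpenMap _ (H1.isOpen_ker φ)
    simpa [K] using! this
  let W : Set Γ := ⋂ q : Γ ⧸ V, (fun g => (t q)⁻¹ * g * t q) ⁻¹' K
  have hW : IsOpen W := isOpen_iInter_of_finite fun q => hK.preimage (by fun_prop)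
  have h1 : (1 : Γ) ∈ W := by simp [W, K.one_mem]
  have key : ∀ g ∈ W, MonoidHom.transfer (H1.toMonoidHom φ) g = 1 := by
    intro g hg
    rw [MonoidHom.transfer_def _ T]
    unfold diff
    refine Finset.prod_eq_one fun q _ => ?_
    obtain ⟨k, hk, hkg⟩ := Set.mem_iInter.1 hg q
    have hq : g • q = q := by
      rw [← ht q]
      refine (QuotientGroup.eq.2 ?_).symm
      have : (t q)⁻¹ * (g • t q) = k := by
        rw [smul_eq_mul, ← mul_assoc]; exact hkg.symm
      rw [this]
      exact k.2
    have hq' : g⁻¹ • q = q := by rw [inv_smul_eq_iff, hq]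
    have : H1.toMonoidHom φ k = 1 := hk
    rw [← this]
    congr 1
    apply Subtype.ext
    simp only [Subgroup.smul_apply_eq_smul_apply_inv_smul, hq', smul_eq_mul]
    rw [← mul_assoc]
    exact hkg.symm
  rw [continuous_iff_continuousAt]
  intro x
  refine (continuousAt_const (y := Multiplicative.toAdd
    (MonoidHom.transfer (H1.toMonoidHom φ) x))).congr ?_
  have : (fun g => x⁻¹ * g) ⁻¹' W ∈ nhds x := by
    refine (hW.preimage (by fun_prop)).mem_nhds ?_
    simpa using h1
  filter_upwards [this] with g hg
  have h2 := key _ hg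
  rw [map_mul, map_inv, inv_mul_eq_one] at h2
  rw [h2]

/-- The corestriction `H¹(V) → H¹(Γ)` for an open subgroup `V` of finite index: in degree one and
with trivial coefficients it is the transfer, explicitly
`(Cor φ)(σ) = ∑_{q ∈ Γ/V} φ(t(q)⁻¹ σ t(σ⁻¹ q))`
for any system of representatives `t` of the left cosets of `V`. -/
def corH1 (V : Subgroup Γ) [V.FiniteIndex] (hV : IsOpen (V : Set Γ)) : H1 p V →+ H1 p Γ where
  toFun φ := ⟨⟨fun g => Multiplicative.toAdd (MonoidHom.transfer (H1.toMonoidHom φ) g),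
    continuous_transfer V hV φ⟩, mem_H1_iff.2 fun σ τ => by
      simp only [ContinuousMap.coe_mk, map_mul, toAdd_mul]⟩
  map_zero' := by
    apply Subtype.ext
    ext g
    change Multiplicative.toAdd (MonoidHom.transfer (1 : V →* Multiplicative (ZMod p)) g) = 0
    rw [MonoidHom.transfer_def _ default, Subgroup.leftTransversals.diff]
    simp
  map_add' φ ψ := by
    apply Subtype.ext
    ext g
    change Multiplicative.toAdd (MonoidHom.transfer
      (H1.toMonoidHom φ * H1.toMonoidHom ψ) g) =
      Multiplicative.toAdd (MonoidHom.transfer (H1.toMonoidHom φ) g) +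
      Multiplicative.toAdd (MonoidHom.transfer (H1.toMonoidHom ψ) g)
    rw [← toAdd_mul]
    congr 1
    rw [MonoidHom.transfer_def _ default, MonoidHom.transfer_def _ default,
      MonoidHom.transfer_def _ default]
    simp only [Subgroup.leftTransversals.diff]
    rw [← Finset.prod_mul_distrib]
    rfl

/-- The sequence `H¹(Ker χ) → H¹(Γ) → H²(Γ) → H²(Ker χ)` with maps `Cor`, `χ ∪ ·`, `Res` is
exact (at both inner terms). -/
def IsExactSeq [NeZero p] (χ : H1 p Γ) : Prop :=
  Function.Exact (corH1 (p := p) (H1.ker χ) (H1.isOpen_ker χ)) (cupH χ) ∧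
    Function.Exact (cupH χ) (pullH2 (p := p) (incl (H1.ker χ)))

/-- The corestriction `H¹(U) → H¹(U')` for open subgroups `U ≤ U'` of finite index in `Γ`:
identify `U` with the subgroup `U.subgroupOf U'` of `U'` and apply `corH1`. -/
def corOfLE (U U' : Subgroup Γ) [U.FiniteIndex] (hU : IsOpen (U : Set Γ)) :
    H1 p U →+ H1 p U' :=
  (corH1 (U.subgroupOf U') (hU.preimage continuous_subtype_val)).comp
    (pullH1 ⟨(U'.subtype.comp (U.subgroupOf U').subtype).codRestrict U fun x => x.2,
      (continuous_subtype_val.comp continuous_subtype_val).subtype_mk _⟩)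

/-- For `N` normal in `Γ` and `σ ∈ Γ`, the homomorphism `N → N`, `τ ↦ σ⁻¹ τ σ`. -/
def conjHom (N : Subgroup Γ) [N.Normal] (σ : Γ) : N →ₜ* N where
  toFun τ := ⟨σ⁻¹ * τ * σ, by simpa using Subgroup.Normal.conj_mem ‹_› (τ : Γ) τ.2 σ⁻¹⟩
  map_one' := by ext; simp
  map_mul' τ ρ := by
    ext
    simp only [Subgroup.coe_mul]
    group
  continuous_toFun := by fun_prop

/-- For `N` normal in `Γ`, the action of `σ ∈ Γ` on `H¹(N)`, `(σφ)(τ) = φ(σ⁻¹ τ σ)`. -/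
def conjH1 (N : Subgroup Γ) [N.Normal] (σ : Γ) : H1 p N →+ H1 p N :=
  pullH1 (conjHom N σ)

end ResCor

/-! ### Fixed points, norms, and `Ĥ⁻¹` -/

section Norm

variable {G : Type*} [Group G] (A : Type*) [AddCommGroup A] [DistribMulAction G A]

/-- The subgroup `A^U` of elements of `A` fixed by `U`. -/
abbrev Inv (U : Subgroup G) : AddSubgroup A := FixedPoints.addSubgroup U A

variable {A}

theorem mem_Inv {U : Subgroup G} {a : A} : a ∈ Inv A U ↔ ∀ u ∈ U, u • a = a :=
  ⟨fun h u hu => h ⟨u, hu⟩, fun h u => h u u.2⟩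

/-- For `U` normal, `G` acts on `A^U`. -/
def smulInv (U : Subgroup G) [U.Normal] (σ : G) (a : Inv A U) : Inv A U :=
  ⟨σ • (a : A), mem_Inv.2 fun u hu => by
    have h := mem_Inv.1 a.2 (σ⁻¹ * u * σ) (by simpa using Subgroup.Normal.conj_mem ‹_› u hu σ⁻¹)
    rw [smul_smul, show u * σ = σ * (σ⁻¹ * u * σ) by group, ← smul_smul, h]⟩

/-- The inclusion `A^{U'} → A^U` for `U ≤ U'`. -/
def inclInv {U U' : Subgroup G} (h : U ≤ U') : Inv A U' →+ Inv A U :=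
  AddSubgroup.inclusion fun _ ha => mem_Inv.2 fun u hu => mem_Inv.1 ha u (h hu)

/-- For `a ∈ A^U`, the element `σ a` depends only on the class of `σ` in `U'/U`. -/
def cosetSMul {U U' : Subgroup G} (a : Inv A U) (q : U' ⧸ U.subgroupOf U') : A :=
  Quotient.liftOn' q (fun σ => (σ : G) • (a : A)) fun σ τ h => by
    have h' : (σ : G)⁻¹ * (τ : G) ∈ U := (QuotientGroup.leftRel_apply (s := U.subgroupOf U')).1 h
    have := mem_Inv.1 a.2 _ h'
    rw [← smul_smul, inv_smul_eq_iff] at this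
    exact this.symm

/-- The norm (trace) map `N_{U'/U} : A^U → A^{U'}`, `a ↦ ∑ σ a`, with `σ` running through a system
of representatives of the cosets of `U'` modulo `U`. -/
def norm (U U' : Subgroup G) [U.FiniteIndex] : Inv A U →+ Inv A U' :=
  letI : Fintype (U' ⧸ U.subgroupOf U') := Subgroup.fintypeQuotientOfFiniteIndex
  { toFun := fun a => ⟨∑ q : U' ⧸ U.subgroupOf U', cosetSMul a q, mem_Inv.2 fun u hu => by
      rw [Finset.smul_sum]
      refine Fintype.sum_equiv (MulAction.toPerm (⟨u, hu⟩ : U')) _ _ fun q => ?_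
      induction q using QuotientGroup.induction_on with
      | H σ => exact smul_smul _ _ _⟩
    map_zero' := by
      apply Subtype.ext
      refine Finset.sum_eq_zero fun q _ => ?_
      induction q using QuotientGroup.induction_on with
      | H σ => exact smul_zero _
    map_add' := fun a b => by
      apply Subtype.ext
      refine Eq.trans (Finset.sum_congr rfl fun q _ => ?_) Finset.sum_add_distrib
      induction q using QuotientGroup.induction_on with
      | H σ => exact smul_add _ _ _ }

variable (A) in
/-- The subgroup `I_{U'/U}` of `A^U` generated by the elements `σ a - a` with `σ ∈ U'` and
`a ∈ A^U`. -/
def augI (U U' : Subgroup G) [U.Normal] : AddSubgroup (Inv A U) :=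
  AddSubgroup.closure {x | ∃ σ ∈ U', ∃ a : Inv A U, x = smulInv U σ a - a}

variable (A) in
/-- The Tate cohomology group `Ĥ⁻¹(U'/U, A^U) = Ker N_{U'/U} / I_{U'/U}`. -/
abbrev TateHNegOne (U U' : Subgroup G) [U.Normal] [U.FiniteIndex] : Type _ :=
  (norm (A := A) U U').ker ⧸ (augI A U U').addSubgroupOf (norm (A := A) U U').ker

end Norm

/-! ### `p`-Kummer formations -/

instance finiteIndex_openNormal {G : Type*} [Group G] [TopologicalSpace G]
    [IsTopologicalGroup G] [CompactSpace G] (U : OpenNormalSubgroup G) :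
    U.toSubgroup.FiniteIndex := by
  have := Subgroup.quotient_finite_of_isOpen U.toSubgroup U.isOpen'
  exact Subgroup.finiteIndex_of_finite_quotient

end KummerFormation

/-- A `p`-Kummer formation `(G, A, {κ_U})` on a profinite group `G` and a discrete `G`-module
`A`. -/
structure PKummerFormation (p : ℕ) [Fact p.Prime] (G : Type*) [Group G] [TopologicalSpace G]
    [IsTopologicalGroup G] [CompactSpace G] [TotallyDisconnectedSpace G]
    (A : Type*) [AddCommGroup A] [TopologicalSpace A] [DiscreteTopology A]
    [DistribMulAction G A] [ContinuousSMul G A] where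
  /-- The homomorphisms `κ_U : A^U → H¹(U)`. -/
  κ : ∀ U : OpenNormalSubgroup G,
    KummerFormation.Inv A U.toSubgroup →+ KummerFormation.H1 p U.toSubgroup
  /-- `κ_U` is an epimorphism. -/
  surjective : ∀ U, Function.Surjective (κ U)
  /-- `κ_U` is `G`-equivariant. -/
  equivariant : ∀ (U : OpenNormalSubgroup G) (σ : G) (a : KummerFormation.Inv A U.toSubgroup),
    κ U (KummerFormation.smulInv U.toSubgroup σ a) =
      KummerFormation.conjH1 U.toSubgroup σ (κ U a)
  /-- `H¹(Ker χ) → H¹(U) → H²(U) → H²(Ker χ)` is exact for every `χ ∈ H¹(U)`. -/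
  exact_seq : ∀ (U : OpenNormalSubgroup G) (χ : KummerFormation.H1 p U.toSubgroup),
    KummerFormation.IsExactSeq χ
  /-- `Ker κ_U = p A^U`. -/
  ker_eq : ∀ (U : OpenNormalSubgroup G) (a : KummerFormation.Inv A U.toSubgroup),
    κ U a = 0 ↔ ∃ b : KummerFormation.Inv A U.toSubgroup, a = p • b
  /-- Compatibility of `κ` with restrictions. -/
  res_comm : ∀ (U U' : OpenNormalSubgroup G) (h : U.toSubgroup ≤ U'.toSubgroup)
    (a : KummerFormation.Inv A U'.toSubgroup),
    κ U (KummerFormation.inclInv h a) =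
      KummerFormation.pullH1 (KummerFormation.inclOfLE h) (κ U' a)
  /-- Compatibility of `κ` with norms and corestrictions. -/
  cor_comm : ∀ (U U' : OpenNormalSubgroup G), U.toSubgroup ≤ U'.toSubgroup →
    ∀ a : KummerFormation.Inv A U.toSubgroup,
    κ U' (KummerFormation.norm U.toSubgroup U'.toSubgroup a) =
      KummerFormation.corOfLE U.toSubgroup U'.toSubgroup U.isOpen' (κ U a)
  /-- `Ĥ⁻¹(U'/U, A^U) = 0` whenever `(U' : U) = p`. -/
  tate_vanishing : ∀ (U U' : OpenNormalSubgroup G), U.toSubgroup ≤ U'.toSubgroup →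
    U.toSubgroup.relIndex U'.toSubgroup = p →
    Subsingleton (KummerFormation.TateHNegOne A U.toSubgroup U'.toSubgroup)

end

/-!
The class of a triple Massey product `⟨χ₁, χ₂, χ₃⟩` given by a defining system `c₁₂`, `c₂₃`
restricts on `Ker χ₁` to `c₁₂ ∪ χ₃`, where `c₁₂` is now a homomorphism. If this restriction
vanishes, then by exactness at `H²` the class is `χ₁ ∪ η` for some `η ∈ H¹(G)`, and replacing
`c₂₃` by `c₂₃ - η` makes it zero (`zero_mem_massey_of_res`). So it suffices to modify `c₁₂` by an
element of `H¹(G)` such that `c₁₂ ∪ χ₃` vanishes on `Ker χ₁`. This is immediate if `χ₁` and `χ₃`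
are linearly dependent.

Otherwise choose `σ`, `τ` in `G` dual to `χ₁`, `χ₃`. As `χ₁ ∪ χ₂ = 0 = χ₃ ∪ χ₂`, exactness at `H¹`
shows that `χ₂` is the Kummer class of a norm of some `x ∈ A^{Ker χ₁}` and of a norm of some
`y ∈ A^{Ker χ₃}`, and the two norms can be made equal in `A^G` (`exists_common_norm`). With
`D = ∑ i σⁱ x` (sum over `i < p`) one has `(σ - 1) D = p x - N x`; hence `c₁₂` on
`Ker χ₁` and `-κ(D)` differ by a `σ`-invariant homomorphism. It vanishes at `σᵖ`, since `χ₂(σ) = κ(x)(σᵖ)` by the formula for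
the transfer (`corH1_apply`), so it extends to `G` (`exists_apply_eq_κ_sum`).

It remains to see that `D` is, modulo `A^G`, a norm from `L = Ker χ₁ ∩ Ker χ₃` to `Ker χ₁`
(`exists_norm_eq_sum_add`). Since `στ` acts on `x` as `σ` and on `y` as `τ`, the element `x - y`
has norm zero for the group of order `p` generated by `στ` modulo `L`. By the vanishing of `Ĥ⁻¹`
it equals `(στ - 1) z` with `z ∈ A^L`. Taking norms with respect to `τ` gives
`(σ - 1) N_τ z = p x - N x = (σ - 1) D`, that is, `N_τ z - D ∈ A^G`. Exactness at `H¹` over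
`Ker χ₁` now shows that `κ(N_τ z) ∪ χ₃` vanishes there.
-/

namespace KummerFormation

/-! ### Cochains and homomorphisms to `ℤ/p` -/

theorem cup_apply {p : ℕ} {Γ : Type*} [TopologicalSpace Γ] (φ ψ : C1 p Γ) (σ τ : Γ) :
    cup φ ψ (σ, τ) = φ σ * ψ τ := rfl

section Cochains

variable {p : ℕ} {Γ : Type*} [Group Γ] [TopologicalSpace Γ] [IsTopologicalGroup Γ]

theorem H2.mk_eq_zero {z : C2 p Γ} (hz : z ∈ Z2 p Γ) : H2.mk z hz = 0 ↔ z ∈ B2 p Γ := by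
  rw [H2.mk, Submodule.Quotient.mk_eq_zero]
  exact Iff.rfl

theorem d1_apply (φ : C1 p Γ) (σ τ : Γ) : d1 p Γ φ (σ, τ) = φ τ - φ (σ * τ) + φ σ := rfl

theorem mem_B2_iff {z : C2 p Γ} :
    z ∈ B2 p Γ ↔ ∃ φ : C1 p Γ, ∀ σ τ, z (σ, τ) = φ τ - φ (σ * τ) + φ σ :=
  ⟨fun ⟨φ, h⟩ => ⟨φ, fun σ τ => by rw [← h, d1_apply]⟩,
    fun ⟨φ, h⟩ => ⟨φ, ContinuousMap.ext fun x => (h x.1 x.2).symm⟩⟩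

/-- Anticommutativity of the cup product on `H¹`: the cochain `-χψ` bounds `ψ ∪ χ + χ ∪ ψ`. -/
theorem cup_add_cup_swap_mem_B2 (χ ψ : H1 p Γ) :
    cup (χ : C1 p Γ) (ψ : C1 p Γ) + cup (ψ : C1 p Γ) (χ : C1 p Γ) ∈ B2 p Γ := by
  refine mem_B2_iff.2 ⟨-((χ : C1 p Γ) * (ψ : C1 p Γ)), fun σ τ => ?_⟩
  simp only [ContinuousMap.add_apply, cup_apply, ContinuousMap.neg_apply, ContinuousMap.mul_apply,
    H1.map_mul]
  ring

theorem cup_swap_mem_B2 {χ ψ : H1 p Γ} (h : cup (χ : C1 p Γ) (ψ : C1 p Γ) ∈ B2 p Γ) :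
    cup (ψ : C1 p Γ) (χ : C1 p Γ) ∈ B2 p Γ :=
  ((B2 p Γ).add_mem_iff_right h).1 (cup_add_cup_swap_mem_B2 χ ψ)

namespace H1

theorem map_one (χ : H1 p Γ) : (χ : C1 p Γ) 1 = 0 := by
  simpa using H1.map_mul χ 1 1

theorem map_inv (χ : H1 p Γ) (σ : Γ) : (χ : C1 p Γ) σ⁻¹ = -(χ : C1 p Γ) σ := by
  have := H1.map_mul χ σ⁻¹ σ
  rw [inv_mul_cancel, H1.map_one] at this
  linear_combination -this

theorem map_pow (χ : H1 p Γ) (σ : Γ) (n : ℕ) : (χ : C1 p Γ) (σ ^ n) = n * (χ : C1 p Γ) σ := by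
  induction n with
  | zero => simp [H1.map_one]
  | succ n ih => rw [pow_succ, H1.map_mul, ih]; push_cast; ring

theorem map_zpow (χ : H1 p Γ) (σ : Γ) (n : ℤ) : (χ : C1 p Γ) (σ ^ n) = n * (χ : C1 p Γ) σ := by
  cases n with
  | ofNat n => simp [H1.map_pow]
  | negSucc n => simp [H1.map_inv, H1.map_pow]; ring

instance normal_ker (χ : H1 p Γ) : (H1.ker χ).Normal := by
  unfold H1.ker
  infer_instance

end H1

/-- If `∂c = χ ∪ ψ`, then `c(σⁿ) = n c(σ) - (0 + 1 + ⋯ + (n - 1)) χ(σ) ψ(σ)`. -/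
theorem apply_pow_of_d1_eq_cup {χ ψ : H1 p Γ} {c : C1 p Γ}
    (h : d1 p Γ c = cup (χ : C1 p Γ) (ψ : C1 p Γ)) (σ : Γ) (n : ℕ) :
    c (σ ^ n) = n * c σ - (∑ i ∈ Finset.range n, (i : ZMod p)) *
      ((χ : C1 p Γ) σ * (ψ : C1 p Γ) σ) := by
  have h' (a b : Γ) : c b - c (a * b) + c a = (χ : C1 p Γ) a * (ψ : C1 p Γ) b :=
    DFunLike.congr_fun h (a, b)
  induction n with
  | zero =>
    have := h' 1 1
    simp [H1.map_one] at this
    simp [this]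
  | succ n ih =>
    have h1 := h' (σ ^ n) σ
    rw [H1.map_pow] at h1
    rw [pow_succ, Finset.sum_range_succ]
    push_cast
    linear_combination ih - h1

/-- An invariant homomorphism `φ` on `Ker χ` extends to `Γ` as soon as it vanishes at `σᵖ`, where
`χ(σ) = 1`: put `Φ(σⁿ v) = φ(v)`. -/
theorem exists_extension [NeZero p] (χ : H1 p Γ) {σ : Γ} (hσ : (χ : C1 p Γ) σ = 1)
    {V : Subgroup Γ} (hV : ∀ g, g ∈ V ↔ (χ : C1 p Γ) g = 0) (φ : H1 p V)
    (hconj : ∀ v w : V, (w : Γ) = σ⁻¹ * v * σ → (φ : C1 p V) w = (φ : C1 p V) v)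
    (hpow : ∀ v : V, (v : Γ) = σ ^ p → (φ : C1 p V) v = 0) :
    ∃ Φ : H1 p Γ, ∀ v : V, (Φ : C1 p Γ) v = (φ : C1 p V) v := by
  have hconj' (n : ℕ) : ∀ v w : V, (w : Γ) = (σ ^ n)⁻¹ * v * σ ^ n →
      (φ : C1 p V) w = (φ : C1 p V) v := by
    induction n with
    | zero =>
      intro v w h
      congr 1
      exact Subtype.ext (by simpa using h)
    | succ n ih =>
      intro v w h
      have hu : (σ ^ n)⁻¹ * v * σ ^ n ∈ V := by
        rw [hV, H1.map_mul, H1.map_mul, H1.map_inv, (hV v).1 v.2]; ring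
      rw [← ih v ⟨_, hu⟩ rfl]
      refine hconj _ _ ?_
      rw [h, pow_succ]
      simp only [mul_inv_rev, mul_assoc]
  have hzpow (k : ℤ) (v : V) (h : (v : Γ) = σ ^ k) : (φ : C1 p V) v = 0 := by
    have hk : (k : ZMod p) = 0 := by
      have := (hV v).1 v.2
      rwa [h, H1.map_zpow, hσ, mul_one] at this
    obtain ⟨m, rfl⟩ := (ZMod.intCast_zmod_eq_zero_iff_dvd k p).1 hk
    have hp : σ ^ p ∈ V := by simp [hV, H1.map_pow]
    have : v = (⟨σ ^ p, hp⟩ : V) ^ m := by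
      apply Subtype.ext
      rw [h, zpow_mul]
      simp
    rw [this, H1.map_zpow, hpow _ rfl, mul_zero]
  -- The representative of `g` in `Ker χ` along the section `i ↦ σⁱ` of `χ`.
  have hr (g : Γ) : (σ ^ ((χ : C1 p Γ) g).val)⁻¹ * g ∈ V := by
    rw [hV, H1.map_mul, H1.map_inv, H1.map_pow, hσ]
    simp
  let r : Γ → V := fun g => ⟨_, hr g⟩
  have hcont : Continuous r := by
    refine Continuous.subtype_mk (Continuous.mul (Continuous.inv ?_) continuous_id) _
    exact (continuous_of_discreteTopology (f := fun a : ZMod p => σ ^ a.val)).comp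
      (χ : C1 p Γ).continuous
  refine ⟨⟨⟨fun g => (φ : C1 p V) (r g), (φ : C1 p V).continuous.comp hcont⟩,
    mem_H1_iff.2 fun g h => ?_⟩, fun v => ?_⟩
  · have hu : (σ ^ ((χ : C1 p Γ) h).val)⁻¹ * (r g : Γ) * σ ^ ((χ : C1 p Γ) h).val ∈ V := by
      rw [hV, H1.map_mul, H1.map_mul, H1.map_inv, (hV _).1 (r g).2]; ring
    have h1 := hconj' _ (r g) ⟨_, hu⟩ rfl
    have h2 := hzpow (-((χ : C1 p Γ) (g * h)).val + ((χ : C1 p Γ) g).val + ((χ : C1 p Γ) h).val)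
      (r (g * h) * ((⟨_, hu⟩ : V) * r h)⁻¹) (by
        simp only [r, Subgroup.coe_mul, Subgroup.coe_inv]
        rw [zpow_add, zpow_add, zpow_neg, zpow_natCast, zpow_natCast, zpow_natCast]
        group)
    rw [H1.map_mul, H1.map_inv, H1.map_mul, h1] at h2
    change (φ : C1 p V) (r (g * h)) = (φ : C1 p V) (r g) + (φ : C1 p V) (r h)
    linear_combination h2
  · change (φ : C1 p V) (r v) = _
    congr 1
    apply Subtype.ext
    simp [r, (hV v).1 v.2]

end Cochains

/-! ### Restriction, corestriction and the exact sequence -/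

@[simp]
theorem pullC2_apply {p : ℕ} {Γ Δ : Type*} [Group Γ] [TopologicalSpace Γ]
    [Group Δ] [TopologicalSpace Δ] (f : Δ →ₜ* Γ) (z : C2 p Γ) (σ τ : Δ) :
    pullC2 f z (σ, τ) = z (f σ, f τ) := rfl

@[simp]
theorem incl_apply {Γ : Type*} [Group Γ] [TopologicalSpace Γ] (V : Subgroup Γ) (v : V) :
    incl V v = v := rfl

section ResCor

variable {p : ℕ} {Γ Δ : Type*} [Group Γ] [TopologicalSpace Γ] [IsTopologicalGroup Γ]
  [Group Δ] [TopologicalSpace Δ] [IsTopologicalGroup Δ]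

theorem pullH2_mk (f : Δ →ₜ* Γ) {z : C2 p Γ} (hz : z ∈ Z2 p Γ) :
    pullH2 f (H2.mk z hz) = H2.mk (pullC2 f z) (pullC2_mem_Z2 f hz) := rfl

theorem conjH1_apply {N : Subgroup Γ} [N.Normal] (σ : Γ) (φ : H1 p N) {v w : N}
    (h : (w : Γ) = σ⁻¹ * v * σ) : (conjH1 N σ φ : C1 p N) v = (φ : C1 p N) w :=
  congrArg (φ : C1 p N) (Subtype.ext h.symm)

/-- The transfer from `V = Ker χ` of a homomorphism `φ`, at an element `σ` with `χ(σ) = 1`, is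
`φ(σᵖ)`: in terms of the transversal `1, σ, …, σᵖ⁻¹`, only one factor is nontrivial. -/
theorem corH1_apply [NeZero p] (χ : H1 p Γ) {σ : Γ} (hσ : (χ : C1 p Γ) σ = 1)
    (V : Subgroup Γ) [V.FiniteIndex] (hVo : IsOpen (V : Set Γ))
    (hV : ∀ g, g ∈ V ↔ (χ : C1 p Γ) g = 0) (φ : H1 p V) (v : V) (hv : (v : Γ) = σ ^ p) :
    (corH1 V hVo φ : C1 p Γ) σ = (φ : C1 p V) v := by
  have hlift (a b : Γ) (h : (a : Γ ⧸ V) = b) : (χ : C1 p Γ) a = (χ : C1 p Γ) b := by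
    have := (hV _).1 (QuotientGroup.eq.1 h)
    rw [H1.map_mul, H1.map_inv] at this
    linear_combination -this
  let e : Γ ⧸ V → ZMod p := fun q => (χ : C1 p Γ) q.out
  have he (g : Γ) : e g = (χ : C1 p Γ) g := hlift _ _ (QuotientGroup.out_eq' _)
  let t : Γ ⧸ V → Γ := fun q => σ ^ (e q).val
  have ht (q : Γ ⧸ V) : (t q : Γ ⧸ V) = q := by
    induction q using QuotientGroup.induction_on with
    | H g =>
      rw [QuotientGroup.eq, hV, H1.map_mul, H1.map_inv]
      simp only [t, he]
      rw [H1.map_pow, hσ]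
      simp
  let T : V.LeftTransversal := ⟨_, Subgroup.isComplement_range_left ht⟩
  have hT (q : Γ ⧸ V) : (T.2.leftQuotientEquiv q : Γ) = t q :=
    Subgroup.IsComplement.leftQuotientEquiv_apply ht q
  change Multiplicative.toAdd (MonoidHom.transfer (H1.toMonoidHom φ) σ) = _
  rw [MonoidHom.transfer_def _ T, Subgroup.leftTransversals.diff]
  simp only [Subgroup.smul_apply_eq_smul_apply_inv_smul, hT, smul_eq_mul]
  have hes (q : Γ ⧸ V) : e (σ⁻¹ • q) = e q - 1 := by
    induction q using QuotientGroup.induction_on with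
    | H g =>
      rw [MulAction.Quotient.smul_coe, he, he, smul_eq_mul, H1.map_mul, H1.map_inv, hσ]
      ring
  have h1 : e ((1 : Γ) : Γ ⧸ V) = 0 := by rw [he, H1.map_one]
  let _ := V.fintypeQuotientOfFiniteIndex
  have hp : p - 1 + 1 = p := Nat.sub_add_cancel (NeZero.pos p)
  refine congrArg Multiplicative.toAdd ((Finset.prod_eq_single ((1 : Γ) : Γ ⧸ V) ?_ ?_).trans ?_)
  · intro q _ hq
    have hq0 : e q ≠ 0 := by
      intro h
      apply hq
      rw [← ht q]
      simp [t, h]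
    refine (congrArg (H1.toMonoidHom φ) (Subtype.ext ?_)).trans (map_one _)
    simp only [t, hes, Subgroup.coe_one]
    have : (e q - 1).val + 1 = (e q).val := by
      obtain ⟨n, hn⟩ := Nat.exists_eq_succ_of_ne_zero ((ZMod.val_ne_zero _).2 hq0)
      have hlt := ZMod.val_lt (e q)
      have : e q - 1 = (n : ZMod p) := by
        rw [← ZMod.natCast_zmod_val (e q), hn]; push_cast; ring
      rw [this, ZMod.val_natCast, Nat.mod_eq_of_lt (by omega), hn]
    rw [← pow_succ', this, inv_mul_cancel]
  · intro h
    exact absurd (Finset.mem_univ _) h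
  · change Multiplicative.ofAdd ((φ : C1 p V) _) = Multiplicative.ofAdd ((φ : C1 p V) v)
    congr 2
    apply Subtype.ext
    simp only [t, hes, h1, hv]
    have : ((0 : ZMod p) - 1).val = p - 1 := by
      have h2 : (0 : ZMod p) - 1 = (p - 1 : ℕ) := by
        rw [Nat.cast_sub (NeZero.pos p)]
        simp
      rw [h2, ZMod.val_natCast, Nat.mod_eq_of_lt (by omega)]
    rw [this, ZMod.val_zero, pow_zero, inv_one, one_mul, ← pow_succ', hp]

/-- Exactness at `H¹` for a subgroup `U ≤ U'` which is the kernel of a homomorphism on `U'`, in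
terms of cochains. -/
theorem cup_mem_B2_iff_exists_corOfLE [NeZero p] {U U' : Subgroup Γ} [U.FiniteIndex]
    (hUo : IsOpen (U : Set Γ)) (hle : U ≤ U') {χ : H1 p U'} (hex : IsExactSeq χ)
    (hU : ∀ g : U', (g : Γ) ∈ U ↔ (χ : C1 p U') g = 0) (ψ : H1 p U') :
    cup (χ : C1 p U') (ψ : C1 p U') ∈ B2 p U' ↔ ∃ φ : H1 p U, corOfLE U U' hUo φ = ψ := by
  have hker : U.subgroupOf U' = H1.ker χ := by
    ext g
    rw [Subgroup.mem_subgroupOf, hU, H1.mem_ker]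
  have key (V : Subgroup U') (hV : V = H1.ker χ) [V.FiniteIndex] (hVo : IsOpen (V : Set U')) :
      Function.Exact (corH1 (p := p) V hVo) (cupH χ) := by
    subst hV
    exact hex.1
  have h1 := key _ hker (hUo.preimage continuous_subtype_val) ψ
  rw [show cupH χ ψ = 0 ↔ _ from H2.mk_eq_zero (cup_mem_Z2 χ ψ)] at h1
  rw [h1]
  constructor
  · rintro ⟨φ, rfl⟩
    let f : U →ₜ* U.subgroupOf U' :=
      ⟨(Subgroup.inclusion hle).codRestrict (U.subgroupOf U') fun x => x.2,
        (continuous_inclusion hle).subtype_mk _⟩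
    exact ⟨pullH1 f φ, rfl⟩
  · rintro ⟨φ, rfl⟩
    exact ⟨_, rfl⟩

/-- Exactness at `H²`, in terms of cochains: a cocycle which is a coboundary on `Ker χ` differs
from some `χ ∪ η` by a coboundary. -/
theorem exists_sub_cup_mem_B2 [NeZero p] {χ : H1 p Γ} (hex : IsExactSeq χ) {z : C2 p Γ}
    (hz : z ∈ Z2 p Γ) (hres : pullC2 (incl (H1.ker χ)) z ∈ B2 p (H1.ker χ)) :
    ∃ η : H1 p Γ, z - cup (χ : C1 p Γ) (η : C1 p Γ) ∈ B2 p Γ := by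
  obtain ⟨η, hη⟩ := (hex.2 (H2.mk z hz)).1 (by rwa [pullH2_mk, H2.mk_eq_zero])
  refine ⟨η, ?_⟩
  have : H2.mk z hz - cupH χ η = 0 := by rw [hη, sub_self]
  exact (H2.mk_eq_zero ((Z2 p Γ).sub_mem hz (cup_mem_Z2 χ η))).1 this

end ResCor

/-! ### Norms and augmentation for cyclic quotients of order `p` -/

section Module

variable {G A : Type*} [Group G] [AddCommGroup A] [DistribMulAction G A]

@[simp]
theorem coe_smulInv (U : Subgroup G) [U.Normal] (σ : G) (a : Inv A U) :
    (smulInv U σ a : A) = σ • (a : A) := rfl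

@[simp]
theorem coe_inclInv {U U' : Subgroup G} (h : U ≤ U') (a : Inv A U') : (inclInv h a : A) = a := rfl

theorem smul_sum_pow (σ : G) (n : ℕ) (a : A) :
    σ • ∑ i ∈ Finset.range n, σ ^ i • a - ∑ i ∈ Finset.range n, σ ^ i • a = σ ^ n • a - a := by
  induction n with
  | zero => simp
  | succ n ih =>
    rw [Finset.sum_range_succ, smul_add, smul_smul, ← pow_succ', add_sub_add_comm, ih]
    abel

/-- The identity `(σ - 1) ∑ i σⁱ = n σⁿ - σ ∑ σⁱ` (sums over `i < n`). -/
theorem smul_sum_nsmul_pow (σ : G) (n : ℕ) (a : A) :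
    σ • ∑ i ∈ Finset.range n, i • σ ^ i • a - ∑ i ∈ Finset.range n, i • σ ^ i • a =
      n • σ ^ n • a - σ • ∑ i ∈ Finset.range n, σ ^ i • a := by
  induction n with
  | zero => simp
  | succ n ih =>
    rw [Finset.sum_range_succ, Finset.sum_range_succ, smul_add, smul_add, add_sub_add_comm, ih,
      smul_comm σ n, smul_smul, ← pow_succ', succ_nsmul]
    abel

end Module

section CyclicNorm

variable {p : ℕ} [NeZero p] {G : Type*} [Group G] [TopologicalSpace G] [IsTopologicalGroup G]
  {A : Type*} [AddCommGroup A] [DistribMulAction G A]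

variable {χ : H1 p G} {σ : G} {U U' : Subgroup G}

/-- The powers `1, σ, …, σᵖ⁻¹` represent the cosets in `U'` of the kernel of `χ` on `U'`. -/
theorem bijective_pow_quotient (hσ : (χ : C1 p G) σ = 1) (hσ' : σ ∈ U')
    (hU : ∀ g, g ∈ U ↔ g ∈ U' ∧ (χ : C1 p G) g = 0) :
    Function.Bijective fun i : Fin p =>
      (((⟨σ, hσ'⟩ : U') ^ (i : ℕ) : U') : U' ⧸ U.subgroupOf U') := by
  have hmk (a b : U') : (a : U' ⧸ U.subgroupOf U') = b ↔
      (χ : C1 p G) a = (χ : C1 p G) b := by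
    rw [QuotientGroup.eq, Subgroup.mem_subgroupOf, hU, Subgroup.coe_mul, Subgroup.coe_inv,
      H1.map_mul, H1.map_inv, neg_add_eq_zero]
    exact and_iff_right (U'.mul_mem (U'.inv_mem a.2) b.2)
  constructor
  · intro i j h
    have := (hmk _ _).1 h
    simp only [Subgroup.coe_pow, H1.map_pow, hσ, mul_one] at this
    have := congrArg ZMod.val this
    rw [ZMod.val_natCast, ZMod.val_natCast, Nat.mod_eq_of_lt i.2, Nat.mod_eq_of_lt j.2] at this
    exact Fin.ext this
  · intro q
    induction q using QuotientGroup.induction_on with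
    | H g =>
      refine ⟨⟨((χ : C1 p G) g).val, ZMod.val_lt _⟩, (hmk _ _).2 ?_⟩
      simp [H1.map_pow, hσ]

theorem relIndex_eq_of_ker (hσ : (χ : C1 p G) σ = 1) (hσ' : σ ∈ U')
    (hU : ∀ g, g ∈ U ↔ g ∈ U' ∧ (χ : C1 p G) g = 0) : U.relIndex U' = p := by
  rw [Subgroup.relIndex, Subgroup.index,
    ← Nat.card_eq_of_bijective _ (bijective_pow_quotient hσ hσ' hU), Nat.card_fin]

theorem coe_norm_eq_sum [U.FiniteIndex] (hσ : (χ : C1 p G) σ = 1) (hσ' : σ ∈ U')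
    (hU : ∀ g, g ∈ U ↔ g ∈ U' ∧ (χ : C1 p G) g = 0) (a : Inv A U) :
    (norm U U' a : A) = ∑ i ∈ Finset.range p, σ ^ i • (a : A) := by
  let _ : Fintype (U' ⧸ U.subgroupOf U') := Subgroup.fintypeQuotientOfFiniteIndex
  change ∑ q : U' ⧸ U.subgroupOf U', cosetSMul a q = _
  rw [← (bijective_pow_quotient hσ hσ' hU).sum_comp, Finset.sum_range]
  rfl

/-- Every element of `U'` is `σⁿ u` for some `u ∈ U`, and `σⁿ - 1` is a multiple of `σ - 1`. -/
theorem exists_smul_sub_of_mem_augI [U.Normal] (hσ : (χ : C1 p G) σ = 1) (hσ' : σ ∈ U')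
    (hU : ∀ g, g ∈ U ↔ g ∈ U' ∧ (χ : C1 p G) g = 0) {x : Inv A U} (hx : x ∈ augI A U U') :
    ∃ z : Inv A U, (x : A) = σ • (z : A) - z := by
  induction hx using AddSubgroup.closure_induction with
  | zero => exact ⟨0, by simp⟩
  | add x y _ _ hx hy =>
    obtain ⟨z, hz⟩ := hx
    obtain ⟨w, hw⟩ := hy
    refine ⟨z + w, ?_⟩
    rw [AddSubgroup.coe_add, AddSubgroup.coe_add, hz, hw, smul_add]
    abel
  | neg x _ hx =>
    obtain ⟨z, hz⟩ := hx
    refine ⟨-z, ?_⟩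
    rw [AddSubgroup.coe_neg, AddSubgroup.coe_neg, hz, smul_neg]
    abel
  | mem x hx =>
    obtain ⟨g, hg, a, rfl⟩ := hx
    have hpow (n : ℕ) : ∃ z : Inv A U, σ ^ n • (a : A) - a = σ • (z : A) - z := by
      induction n with
      | zero => exact ⟨0, by simp⟩
      | succ n ih =>
        obtain ⟨z, hz⟩ := ih
        refine ⟨z + smulInv U (σ ^ n) a, ?_⟩
        rw [AddSubgroup.coe_add, coe_smulInv, smul_add, smul_smul, ← pow_succ',
          eq_add_of_sub_eq hz]
        abel
    obtain ⟨z, hz⟩ := hpow ((χ : C1 p G) g).val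
    refine ⟨z, ?_⟩
    rw [← hz, AddSubgroup.coe_sub, coe_smulInv]
    have hu : (σ ^ ((χ : C1 p G) g).val)⁻¹ * g ∈ U := by
      rw [hU, H1.map_mul, H1.map_inv, H1.map_pow, hσ]
      exact ⟨U'.mul_mem (U'.inv_mem (U'.pow_mem hσ' _)) hg, by simp⟩
    have := mem_Inv.1 a.2 _ hu
    rw [← smul_smul, inv_smul_eq_iff] at this
    rw [this]

end CyclicNorm

/-! ### The kernel of a homomorphism as an open normal subgroup -/

section OpenNormal

variable {p : ℕ} {G : Type*} [Group G] [TopologicalSpace G] [IsTopologicalGroup G]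

/-- The kernel of `χ ∈ H¹(G)` as an open normal subgroup. -/
def openKer (χ : H1 p G) : OpenNormalSubgroup G where
  toSubgroup := H1.ker χ
  isOpen' := H1.isOpen_ker χ
  isNormal' := H1.normal_ker χ

theorem mem_openKer {χ : H1 p G} {g : G} :
    g ∈ (openKer χ).toSubgroup ↔ (χ : C1 p G) g = 0 := H1.mem_ker

/-- The whole group as an open normal subgroup. -/
def openTop (G : Type*) [Group G] [TopologicalSpace G] : OpenNormalSubgroup G where
  toSubgroup := ⊤
  isOpen' := isOpen_univ
  isNormal' := inferInstance

theorem le_openTop {G : Type*} [Group G] [TopologicalSpace G] (U : Subgroup G) :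
    U ≤ (openTop G).toSubgroup := fun g _ => Subgroup.mem_top g

theorem mem_openTop {G : Type*} [Group G] [TopologicalSpace G] (g : G) :
    g ∈ (openTop G).toSubgroup := Subgroup.mem_top g

theorem mem_openKer_iff_mem_openTop_and {χ : H1 p G} (g : G) :
    g ∈ (openKer χ).toSubgroup ↔ g ∈ (openTop G).toSubgroup ∧ (χ : C1 p G) g = 0 :=
  mem_openKer.trans (and_iff_right (mem_openTop g)).symm

/-- The identification of `G` with the subgroup `⊤`. -/
def toTop (G : Type*) [Group G] [TopologicalSpace G] : G →ₜ* (openTop G).toSubgroup where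
  toFun g := ⟨g, Subgroup.mem_top g⟩
  map_one' := rfl
  map_mul' _ _ := rfl
  continuous_toFun := continuous_id.subtype_mk _

end OpenNormal

/-! ### Kummer formations -/

section Formation

variable {p : ℕ} [Fact p.Prime] {G : Type*} [Group G] [TopologicalSpace G] [IsTopologicalGroup G]
  [CompactSpace G] [TotallyDisconnectedSpace G]
  {A : Type*} [AddCommGroup A] [TopologicalSpace A] [DiscreteTopology A]
  [DistribMulAction G A] [ContinuousSMul G A]

/-- Hilbert 90: if the quotient `U'/U` is generated by `σ`, of order `p`, an element of norm zero
has the form `(σ - 1) z`. -/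
theorem exists_smul_sub_of_norm_eq_zero (K : PKummerFormation p G A)
    {U U' : OpenNormalSubgroup G} {χ : H1 p G} {σ : G}
    (hσ : (χ : C1 p G) σ = 1) (hσ' : σ ∈ U'.toSubgroup)
    (hU : ∀ g, g ∈ U.toSubgroup ↔ g ∈ U'.toSubgroup ∧ (χ : C1 p G) g = 0)
    (x : Inv A U.toSubgroup) (hx : ∑ i ∈ Finset.range p, σ ^ i • (x : A) = 0) :
    ∃ z : Inv A U.toSubgroup, (x : A) = σ • (z : A) - z := by
  have hle : U.toSubgroup ≤ U'.toSubgroup := fun g hg => ((hU g).1 hg).1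
  have := K.tate_vanishing U U' hle (relIndex_eq_of_ker hσ hσ' hU)
  have hx' : x ∈ (norm (A := A) U.toSubgroup U'.toSubgroup).ker := by
    rw [AddMonoidHom.mem_ker]
    apply Subtype.ext
    rw [coe_norm_eq_sum hσ hσ' hU, hx]
    rfl
  have h0 := (QuotientAddGroup.eq_zero_iff (N := (augI A U.toSubgroup U'.toSubgroup).addSubgroupOf
    (norm (A := A) U.toSubgroup U'.toSubgroup).ker) ⟨x, hx'⟩).1 (Subsingleton.elim _ _)
  exact exists_smul_sub_of_mem_augI hσ hσ' hU (AddSubgroup.mem_addSubgroupOf.1 h0)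

variable (K : PKummerFormation p G A)

/-- Exactness at `H¹(U')` in terms of the formation: `χ ∪ ψ` vanishes in `H²(U')` if and only if `ψ`
is the Kummer class of a norm from the kernel `U` of `χ`. -/
theorem cup_mem_B2_iff_exists_norm {U U' : OpenNormalSubgroup G}
    (hle : U.toSubgroup ≤ U'.toSubgroup) {χ : H1 p U'.toSubgroup}
    (hU : ∀ g : U'.toSubgroup, (g : G) ∈ U.toSubgroup ↔ (χ : C1 p U'.toSubgroup) g = 0)
    (ψ : H1 p U'.toSubgroup) :
    cup (χ : C1 p U'.toSubgroup) (ψ : C1 p U'.toSubgroup) ∈ B2 p U'.toSubgroup ↔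
      ∃ a : Inv A U.toSubgroup, K.κ U' (norm U.toSubgroup U'.toSubgroup a) = ψ := by
  rw [cup_mem_B2_iff_exists_corOfLE U.isOpen' hle (K.exact_seq U' χ) hU]
  constructor
  · rintro ⟨φ, rfl⟩
    obtain ⟨a, rfl⟩ := K.surjective U φ
    exact ⟨a, K.cor_comm U U' hle a⟩
  · rintro ⟨a, rfl⟩
    exact ⟨_, (K.cor_comm U U' hle a).symm⟩

/-- The corestriction `Cor κ(x) = κ(N x)` at a generator `σ`, on the level of Kummer classes. -/
theorem κ_norm_apply {U U' : OpenNormalSubgroup G} {χ : H1 p G} {σ : G}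
    (hσ : (χ : C1 p G) σ = 1) (hσ' : σ ∈ U'.toSubgroup)
    (hU : ∀ g, g ∈ U.toSubgroup ↔ g ∈ U'.toSubgroup ∧ (χ : C1 p G) g = 0)
    (x : Inv A U.toSubgroup) (v : U.toSubgroup) (hv : (v : G) = σ ^ p) :
    (K.κ U' (norm U.toSubgroup U'.toSubgroup x) : C1 p U'.toSubgroup) ⟨σ, hσ'⟩ =
      (K.κ U x : C1 p U.toSubgroup) v := by
  rw [K.cor_comm U U' (fun g hg => ((hU g).1 hg).1)]
  refine corH1_apply (pullH1 (incl U'.toSubgroup) χ) (σ := ⟨σ, hσ'⟩) hσ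
    (U.toSubgroup.subgroupOf U'.toSubgroup) (U.isOpen'.preimage continuous_subtype_val)
    (fun g => ?_) _ ⟨⟨v, ((hU _).1 v.2).1⟩, v.2⟩ (Subtype.ext hv)
  rw [Subgroup.mem_subgroupOf, hU]
  exact and_iff_right g.2

theorem κ_smul_apply (U : OpenNormalSubgroup G) (σ : G) (a : Inv A U.toSubgroup)
    {v w : U.toSubgroup} (h : (w : G) = σ⁻¹ * v * σ) :
    (K.κ U (smulInv U.toSubgroup σ a) : C1 p U.toSubgroup) v =
      (K.κ U a : C1 p U.toSubgroup) w := by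
  rw [K.equivariant, conjH1_apply σ _ h]

end Formation

/-! ### Interpolating between two norms -/

section Interpolation

variable {p : ℕ} [Fact p.Prime] {G : Type*} [Group G] [TopologicalSpace G] [IsTopologicalGroup G]
  {A : Type*} [AddCommGroup A] [DistribMulAction G A]

/-- On elements fixed by `Ker χ`, the action of `g` depends only on `χ(g)`. -/
theorem smul_eq_smul_of_apply_eq {χ : H1 p G} {a : A} (ha : a ∈ Inv A (openKer χ).toSubgroup)
    {g h : G} (hgh : (χ : C1 p G) g = (χ : C1 p G) h) : g • a = h • a := by
  have : h⁻¹ * g ∈ (openKer χ).toSubgroup := by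
    rw [mem_openKer, H1.map_mul, H1.map_inv, hgh, neg_add_cancel]
  have := mem_Inv.1 ha _ this
  rwa [← smul_smul, inv_smul_eq_iff] at this

/-- On elements fixed by `Ker χ ∩ Ker ψ`, the action of `g` depends only on `χ(g)` and `ψ(g)`. -/
theorem smul_eq_smul_of_apply_eq_of_apply_eq {χ ψ : H1 p G} {a : A}
    (ha : a ∈ Inv A (openKer χ ⊓ openKer ψ).toSubgroup) {g h : G}
    (hχ : (χ : C1 p G) g = (χ : C1 p G) h) (hψ : (ψ : C1 p G) g = (ψ : C1 p G) h) :
    g • a = h • a := by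
  have : h⁻¹ * g ∈ (openKer χ ⊓ openKer ψ).toSubgroup := by
    refine ⟨mem_openKer.2 ?_, mem_openKer.2 ?_⟩
    · rw [H1.map_mul, H1.map_inv, hχ, neg_add_cancel]
    · rw [H1.map_mul, H1.map_inv, hψ, neg_add_cancel]
  have := mem_Inv.1 ha _ this
  rwa [← smul_smul, inv_smul_eq_iff] at this

variable [CompactSpace G] [TotallyDisconnectedSpace G] [TopologicalSpace A] [DiscreteTopology A]
  [ContinuousSMul G A]

/-- The heart of the argument. Let `σ`, `τ` be dual to `χ₁`, `χ₃`, and let `x`, `y` be fixed by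
`Ker χ₁`, `Ker χ₃` and have the same norm to `A^G`. Then the operator `∑ i σⁱ`, applied to `x`,
gives a norm from `Ker χ₁ ∩ Ker χ₃`, up to an element of `A^G`: the element `x - y` has norm zero
with respect to `στ`, so is `(στ - 1) z`, and the norm of `z` is the one required. -/
theorem exists_norm_eq_sum_add (K : PKummerFormation p G A)
    {χ₁ χ₃ : H1 p G} {σ τ : G}
    (hσ₁ : (χ₁ : C1 p G) σ = 1) (hσ₃ : (χ₃ : C1 p G) σ = 0)
    (hτ₁ : (χ₁ : C1 p G) τ = 0) (hτ₃ : (χ₃ : C1 p G) τ = 1)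
    (x : Inv A (openKer χ₁).toSubgroup) (y : Inv A (openKer χ₃).toSubgroup)
    (hxy : ∑ i ∈ Finset.range p, σ ^ i • (x : A) = ∑ i ∈ Finset.range p, τ ^ i • (y : A)) :
    ∃ (z : Inv A (openKer χ₁ ⊓ openKer χ₃).toSubgroup) (f : Inv A (openTop G).toSubgroup),
      (norm (openKer χ₁ ⊓ openKer χ₃).toSubgroup (openKer χ₁).toSubgroup z : A) =
        ∑ i ∈ Finset.range p, i • σ ^ i • (x : A) + f := by
  -- `Ker χ₁ ∩ Ker χ₃` is the kernel of `χ₁` on `Ker (χ₁ - χ₃)`, and `στ` generates the quotient.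
  have hmem (g : G) : g ∈ (openKer χ₁ ⊓ openKer χ₃).toSubgroup ↔
      (χ₁ : C1 p G) g = 0 ∧ (χ₃ : C1 p G) g = 0 :=
    and_congr mem_openKer mem_openKer
  have hle₁ : (openKer χ₁ ⊓ openKer χ₃).toSubgroup ≤ (openKer χ₁).toSubgroup := fun g hg => hg.1
  have hle₃ : (openKer χ₁ ⊓ openKer χ₃).toSubgroup ≤ (openKer χ₃).toSubgroup := fun g hg => hg.2
  have hστ₁ : (χ₁ : C1 p G) (σ * τ) = 1 := by rw [H1.map_mul, hσ₁, hτ₁, add_zero]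
  have hστ₃ : (χ₃ : C1 p G) (σ * τ) = 1 := by rw [H1.map_mul, hσ₃, hτ₃, zero_add]
  have hdiff (g : G) : g ∈ (openKer (χ₁ - χ₃)).toSubgroup ↔
      (χ₁ : C1 p G) g - (χ₃ : C1 p G) g = 0 := mem_openKer
  obtain ⟨z, hz⟩ := exists_smul_sub_of_norm_eq_zero K (U := openKer χ₁ ⊓ openKer χ₃)
    (U' := openKer (χ₁ - χ₃)) hστ₁ (by rw [hdiff, hστ₁, hστ₃, sub_self])
    (fun g => by
      rw [hmem, hdiff]
      constructor
      · rintro ⟨h₁, h₃⟩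
        exact ⟨by rw [h₁, h₃, sub_self], h₁⟩
      · rintro ⟨h, h₁⟩
        exact ⟨h₁, by rwa [h₁, zero_sub, neg_eq_zero] at h⟩)
    (inclInv hle₁ x - inclInv hle₃ y) (by
      rw [AddSubgroup.coe_sub, coe_inclInv, coe_inclInv]
      simp only [smul_sub]
      rw [Finset.sum_sub_distrib, sub_eq_zero]
      refine Eq.trans (Finset.sum_congr rfl fun i _ => ?_)
        (hxy.trans (Finset.sum_congr rfl fun i _ => ?_))
      · exact smul_eq_smul_of_apply_eq x.2 (by rw [H1.map_pow, H1.map_pow, hστ₁, hσ₁])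
      · exact smul_eq_smul_of_apply_eq y.2 (by rw [H1.map_pow, H1.map_pow, hστ₃, hτ₃]))
  rw [AddSubgroup.coe_sub, coe_inclInv, coe_inclInv] at hz
  have hw := coe_norm_eq_sum (χ := χ₃) hτ₃ (U := (openKer χ₁ ⊓ openKer χ₃).toSubgroup)
    (U' := (openKer χ₁).toSubgroup) (mem_openKer.2 hτ₁)
    (fun g => by rw [hmem, mem_openKer]) z
  set w := norm (openKer χ₁ ⊓ openKer χ₃).toSubgroup (openKer χ₁).toSubgroup z
  set D : A := ∑ i ∈ Finset.range p, i • σ ^ i • (x : A) with hD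
  -- The norm with respect to `τ` of `x - y = (στ - 1) z`, computed in two ways.
  have h1 : ∑ i ∈ Finset.range p, τ ^ i • ((x : A) - y) =
      p • (x : A) - ∑ i ∈ Finset.range p, σ ^ i • (x : A) := by
    simp only [smul_sub]
    rw [Finset.sum_sub_distrib, hxy, Finset.sum_congr rfl fun i _ =>
      (smul_eq_smul_of_apply_eq x.2 (g := τ ^ i) (h := 1)
        (by rw [H1.map_pow, hτ₁, mul_zero, H1.map_one])).trans (one_smul G _),
      Finset.sum_const, Finset.card_range]
  have h2 : ∑ i ∈ Finset.range p, τ ^ i • ((x : A) - y) = σ • (w : A) - w := by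
    have h3 : σ • (w : A) = (σ * τ) • (w : A) :=
      smul_eq_smul_of_apply_eq w.2 (by rw [hσ₁, hστ₁])
    rw [hz, h3, hw, Finset.smul_sum, ← Finset.sum_sub_distrib]
    refine Finset.sum_congr rfl fun i _ => ?_
    rw [smul_sub, smul_smul, smul_smul]
    congr 1
    refine smul_eq_smul_of_apply_eq_of_apply_eq z.2 ?_ ?_ <;>
      rw [H1.map_mul, H1.map_mul _ (σ * τ), add_comm]
  have hpσ : σ ^ p • (x : A) = x :=
    (smul_eq_smul_of_apply_eq x.2 (by simp [H1.map_pow, H1.map_one])).trans (one_smul G _)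
  have h3 : σ • D - D = σ • (w : A) - w := by
    have h4 := smul_sum_pow σ p (x : A)
    rw [hpσ, sub_self, sub_eq_zero] at h4
    rw [hD, smul_sum_nsmul_pow, hpσ, h4, ← h1, h2]
  have hDmem : D ∈ Inv A (openKer χ₁).toSubgroup :=
    AddSubgroup.sum_mem _ fun i _ => AddSubgroup.nsmul_mem _
      (smulInv (openKer χ₁).toSubgroup (σ ^ i) x).2 _
  have hf : (w : A) - D ∈ Inv A (openTop G).toSubgroup := by
    refine mem_Inv.2 fun g _ => ?_
    have hfmem := AddSubgroup.sub_mem _ w.2 hDmem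
    have hfσ : σ • ((w : A) - D) = w - D := by
      rw [smul_sub, sub_eq_sub_iff_sub_eq_sub, h3]
    have hfpow (n : ℕ) : σ ^ n • ((w : A) - D) = w - D := by
      induction n with
      | zero => simp
      | succ n ih => rw [pow_succ, ← smul_smul, hfσ, ih]
    rw [smul_eq_smul_of_apply_eq hfmem (h := σ ^ ((χ₁ : C1 p G) g).val)
      (by simp [H1.map_pow, hσ₁]), hfpow]
  exact ⟨z, ⟨_, hf⟩, (add_sub_cancel _ _).symm⟩

end Interpolation

/-! ### Defining systems over `Ker χ₁` -/

section DefiningSystem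

variable {p : ℕ} [Fact p.Prime] {G : Type*} [Group G] [TopologicalSpace G] [IsTopologicalGroup G]
  [CompactSpace G] [TotallyDisconnectedSpace G]
  {A : Type*} [AddCommGroup A] [TopologicalSpace A] [DiscreteTopology A]
  [DistribMulAction G A] [ContinuousSMul G A] (K : PKummerFormation p G A)

/-- If `χ ∪ ψ` and `χ' ∪ ψ` vanish in `H²(G)`, then `ψ` is the Kummer class of a common norm from
`Ker χ` and from `Ker χ'`. -/
theorem exists_common_norm {χ χ' ψ : H1 p G} {σ τ : G}
    (hσ : (χ : C1 p G) σ = 1) (hτ : (χ' : C1 p G) τ = 1)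
    (h : cup (χ : C1 p G) (ψ : C1 p G) ∈ B2 p G)
    (h' : cup (χ' : C1 p G) (ψ : C1 p G) ∈ B2 p G) :
    ∃ (x : Inv A (openKer χ).toSubgroup) (y : Inv A (openKer χ').toSubgroup),
      ∑ i ∈ Finset.range p, σ ^ i • (x : A) = ∑ i ∈ Finset.range p, τ ^ i • (y : A) ∧
      K.κ (openTop G) (norm (openKer χ).toSubgroup (openTop G).toSubgroup x) =
        pullH1 (incl (openTop G).toSubgroup) ψ := by
  obtain ⟨x, hx⟩ := (cup_mem_B2_iff_exists_norm K (U := openKer χ) (U' := openTop G) (le_openTop _)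
    (χ := pullH1 (incl (openTop G).toSubgroup) χ) (fun g => mem_openKer)
    (pullH1 (incl _) ψ)).1 (pullC2_mem_B2 (incl (openTop G).toSubgroup) h)
  obtain ⟨y, hy⟩ := (cup_mem_B2_iff_exists_norm K (U := openKer χ') (U' := openTop G) (le_openTop _)
    (χ := pullH1 (incl (openTop G).toSubgroup) χ') (fun g => mem_openKer)
    (pullH1 (incl _) ψ)).1 (pullC2_mem_B2 (incl (openTop G).toSubgroup) h')
  -- The two norms agree modulo `p A^G`, and `p f` is the norm of `f ∈ A^G`.
  obtain ⟨f, hf⟩ := (K.ker_eq (openTop G)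
    (norm (openKer χ).toSubgroup (openTop G).toSubgroup x -
      norm (openKer χ').toSubgroup (openTop G).toSubgroup y)).1 (by rw [map_sub, hx, hy, sub_self])
  have hnf : norm (openKer χ).toSubgroup (openTop G).toSubgroup (inclInv (le_openTop _) f) =
      p • f := by
    apply Subtype.ext
    rw [coe_norm_eq_sum hσ (mem_openTop σ) mem_openKer_iff_mem_openTop_and, coe_inclInv,
      Finset.sum_congr rfl fun i _ => mem_Inv.1 f.2 (σ ^ i) (mem_openTop _), Finset.sum_const,
      Finset.card_range]
    rfl
  have hxy : norm (openKer χ).toSubgroup (openTop G).toSubgroup (x - inclInv (le_openTop _) f) =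
      norm (openKer χ').toSubgroup (openTop G).toSubgroup y := by
    rw [map_sub, hnf, ← hf, sub_sub_cancel]
  refine ⟨x - inclInv (le_openTop _) f, y, ?_, by rw [hxy, hy]⟩
  rw [← coe_norm_eq_sum hσ (mem_openTop σ) mem_openKer_iff_mem_openTop_and,
    ← coe_norm_eq_sum hτ (mem_openTop τ) mem_openKer_iff_mem_openTop_and, hxy]

/-- If `∂c = χ ∪ ψ` and `ψ` is the Kummer class of the norm of `x`, then, up to an element of
`H¹(G)`, the homomorphism `c` on `Ker χ` is the Kummer class of `-∑ i σⁱ x`: the sum of the two is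
`σ`-invariant, since `(σ - 1) ∑ i σⁱ x` is `p x - N x`, and it vanishes at `σᵖ`. -/
theorem exists_apply_eq_κ_sum {χ ψ : H1 p G} {σ : G} (hσ : (χ : C1 p G) σ = 1) {c : C1 p G}
    (hc : d1 p G c = cup (χ : C1 p G) (ψ : C1 p G)) (x : Inv A (openKer χ).toSubgroup)
    (hx : K.κ (openTop G) (norm (openKer χ).toSubgroup (openTop G).toSubgroup x) =
      pullH1 (incl (openTop G).toSubgroup) ψ) :
    ∃ Φ : H1 p G, ∀ v : (openKer χ).toSubgroup, c v = (Φ : C1 p G) v -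
      (K.κ (openKer χ) (∑ i ∈ Finset.range p, i • smulInv (openKer χ).toSubgroup (σ ^ i) x) :
        C1 p (openKer χ).toSubgroup) v := by
  have hc' (a b : G) : c b - c (a * b) + c a = (χ : C1 p G) a * (ψ : C1 p G) b :=
    DFunLike.congr_fun hc (a, b)
  set D : Inv A (openKer χ).toSubgroup :=
    ∑ i ∈ Finset.range p, i • smulInv (openKer χ).toSubgroup (σ ^ i) x with hD
  have hDA : (D : A) = ∑ i ∈ Finset.range p, i • σ ^ i • (x : A) := by
    rw [hD, AddSubgroup.val_finsetSum]
    rfl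
  have hpσ : σ ^ p • (x : A) = x :=
    (smul_eq_smul_of_apply_eq x.2 (by simp [H1.map_pow, H1.map_one])).trans (one_smul G _)
  have hσD : smulInv (openKer χ).toSubgroup σ D = D + p • x -
      inclInv (le_openTop _) (norm (openKer χ).toSubgroup (openTop G).toSubgroup x) := by
    apply Subtype.ext
    have h4 := smul_sum_pow σ p (x : A)
    rw [hpσ, sub_self, sub_eq_zero] at h4
    have h5 := smul_sum_nsmul_pow σ p (x : A)
    rw [hpσ, h4, ← hDA, sub_eq_iff_eq_add'] at h5
    rw [coe_smulInv, h5, AddSubgroup.coe_sub, AddSubgroup.coe_add, coe_inclInv,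
      coe_norm_eq_sum hσ (mem_openTop σ) mem_openKer_iff_mem_openTop_and, add_sub_assoc]
    rfl
  let ψc : H1 p (openKer χ).toSubgroup :=
    ⟨c.comp ⟨_, (incl (openKer χ).toSubgroup).continuous_toFun⟩, mem_H1_iff.2 fun v w => by
      have h1 := hc' v w
      rw [mem_openKer.1 v.2] at h1
      change c (v * w) = c v + c w
      linear_combination -h1⟩
  obtain ⟨Φ, hΦ⟩ := exists_extension χ hσ (fun g => mem_openKer) (ψc + K.κ (openKer χ) D)
    (fun v w hvw => by
      have h1 := hc' v σ
      have h2 := hc' σ w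
      have h3 : σ * (w : G) = v * σ := by rw [hvw]; group
      have h4 : (ψ : C1 p G) w = (ψ : C1 p G) v := by
        rw [hvw, H1.map_mul, H1.map_mul, H1.map_inv]; ring
      rw [mem_openKer.1 v.2] at h1
      rw [hσ, h3, h4] at h2
      have h5 := κ_smul_apply K (openKer χ) σ D hvw
      have h6 : K.κ (openKer χ)
          (inclInv (le_openTop _) (norm (openKer χ).toSubgroup (openTop G).toSubgroup x)) =
          pullH1 (incl _) ψ := by
        rw [K.res_comm (openKer χ) (openTop G) (le_openTop _), hx]
        rfl
      rw [hσD, map_sub, map_add, h6, (K.ker_eq (openKer χ) (p • x)).2 ⟨x, rfl⟩, add_zero] at h5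
      change (K.κ (openKer χ) D : C1 p (openKer χ).toSubgroup) v - (ψ : C1 p G) v = _ at h5
      change c w + (K.κ (openKer χ) D : C1 p (openKer χ).toSubgroup) w =
        c v + (K.κ (openKer χ) D : C1 p (openKer χ).toSubgroup) v
      linear_combination h2 - h1 - h5)
    (fun v hv => by
      -- Both values are `∑ i` times `ψ(σ)`, up to sign; for `p = 2` the sum is `1`, not `0`.
      have h1 := κ_norm_apply K hσ (mem_openTop σ) mem_openKer_iff_mem_openTop_and x v hv
      rw [hx] at h1
      change (ψ : C1 p G) σ = _ at h1
      have h2 := apply_pow_of_d1_eq_cup hc σ p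
      rw [hσ, one_mul, CharP.cast_eq_zero, zero_mul, zero_sub, ← hv] at h2
      have h3 : (K.κ (openKer χ) D : C1 p (openKer χ).toSubgroup) v =
          (∑ i ∈ Finset.range p, (i : ZMod p)) *
            (K.κ (openKer χ) x : C1 p (openKer χ).toSubgroup) v := by
        rw [hD, map_sum, AddSubmonoidClass.coe_finsetSum, ContinuousMap.sum_apply,
          Finset.sum_mul]
        refine Finset.sum_congr rfl fun i _ => ?_
        rw [map_nsmul, ← κ_smul_apply K (openKer χ) (σ ^ i) x (v := v) (w := v)
          (by rw [hv]; group)]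
        simp
      change c v + (K.κ (openKer χ) D : C1 p (openKer χ).toSubgroup) v = 0
      rw [h2, h3, h1]
      ring)
  refine ⟨Φ, fun v => ?_⟩
  rw [hΦ v]
  exact (add_sub_cancel_right _ _).symm

/-- Exactness at `H²(G)`: a cocycle which is a coboundary on `Ker χ` differs from some `χ ∪ η` by
a coboundary. -/
theorem exists_sub_cup_mem_B2_of_res (K : PKummerFormation p G A) (χ : H1 p G)
    {z : C2 p G} (hz : z ∈ Z2 p G)
    (hres : pullC2 (incl (H1.ker χ)) z ∈ B2 p (H1.ker χ)) :
    ∃ η : H1 p G, z - cup (χ : C1 p G) (η : C1 p G) ∈ B2 p G := by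
  let ι := incl (openTop G).toSubgroup
  let f : H1.ker (pullH1 (p := p) ι χ) →ₜ* H1.ker χ :=
    ⟨((openTop G).toSubgroup.subtype.comp (H1.ker (pullH1 ι χ)).subtype).codRestrict (H1.ker χ)
      fun g => g.2, (continuous_subtype_val.comp continuous_subtype_val).subtype_mk _⟩
  obtain ⟨η, hη⟩ := exists_sub_cup_mem_B2 (K.exact_seq (openTop G) (pullH1 ι χ))
    (pullC2_mem_Z2 ι hz) (pullC2_mem_B2 f hres)
  exact ⟨pullH1 (toTop G) η, pullC2_mem_B2 (toTop G) hη⟩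

/-- If `c₁₂ ∪ χ₃` becomes a coboundary on `Ker χ₁`, then the Massey product contains zero. -/
theorem zero_mem_massey_of_res (K : PKummerFormation p G A)
    {χ₁ χ₂ χ₃ : H1 p G} {c₁₂ c₂₃ : C1 p G}
    (h₁₂ : d1 p G c₁₂ = cup (χ₁ : C1 p G) (χ₂ : C1 p G))
    (h₂₃ : d1 p G c₂₃ = cup (χ₂ : C1 p G) (χ₃ : C1 p G))
    (hres : pullC2 (incl (H1.ker χ₁)) (cup c₁₂ (χ₃ : C1 p G)) ∈ B2 p (H1.ker χ₁)) :
    (0 : H2 p G) ∈ massey χ₁ χ₂ χ₃ := by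
  obtain ⟨η, hη⟩ := exists_sub_cup_mem_B2_of_res K χ₁ (massey_mem_Z2 h₁₂ h₂₃) (by
    convert hres using 1
    ext ⟨v, w⟩
    have : (χ₁ : C1 p G) v = 0 := H1.mem_ker.1 v.2
    simp [cup_apply, this])
  have h : d1 p G (c₂₃ - η) = cup (χ₂ : C1 p G) (χ₃ : C1 p G) := by
    rw [map_sub, LinearMap.mem_ker.1 η.2, sub_zero, h₂₃]
  refine ⟨c₁₂, c₂₃ - η, h₁₂, h, ((H2.mk_eq_zero _).2 ?_).symm⟩
  convert hη using 1
  ext ⟨v, w⟩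
  simp only [ContinuousMap.add_apply, ContinuousMap.sub_apply, cup_apply]
  ring

/-- The case where `χ₁` and `χ₃` are linearly independent, expressed by dual elements `σ`, `τ`. -/
theorem zero_mem_massey_of_dual (K : PKummerFormation p G A)
    {χ₁ χ₂ χ₃ : H1 p G} {σ τ : G}
    (hσ₁ : (χ₁ : C1 p G) σ = 1) (hσ₃ : (χ₃ : C1 p G) σ = 0)
    (hτ₁ : (χ₁ : C1 p G) τ = 0) (hτ₃ : (χ₃ : C1 p G) τ = 1) {c₁₂ c₂₃ : C1 p G}
    (h₁₂ : d1 p G c₁₂ = cup (χ₁ : C1 p G) (χ₂ : C1 p G))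
    (h₂₃ : d1 p G c₂₃ = cup (χ₂ : C1 p G) (χ₃ : C1 p G)) :
    (0 : H2 p G) ∈ massey χ₁ χ₂ χ₃ := by
  obtain ⟨x, y, hxy, hx⟩ := exists_common_norm K hσ₁ hτ₃ ⟨c₁₂, h₁₂⟩ (cup_swap_mem_B2 ⟨c₂₃, h₂₃⟩)
  obtain ⟨z, f, hzf⟩ := exists_norm_eq_sum_add K hσ₁ hσ₃ hτ₁ hτ₃ x y hxy
  obtain ⟨Φ, hΦ⟩ := exists_apply_eq_κ_sum K hσ₁ h₁₂ x hx
  set N := norm (openKer χ₁ ⊓ openKer χ₃).toSubgroup (openKer χ₁).toSubgroup z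
  have hNf : N = ∑ i ∈ Finset.range p, i • smulInv (openKer χ₁).toSubgroup (σ ^ i) x +
      inclInv (le_openTop _) f := by
    apply Subtype.ext
    rw [hzf, AddSubgroup.coe_add, AddSubgroup.val_finsetSum]
    rfl
  -- The corrected cochain restricts to `-κ(N z)` on `Ker χ₁`, and `κ(N z) ∪ χ₃` vanishes there.
  let Ψ : H1 p G := Φ + pullH1 (toTop G) (K.κ (openTop G) f)
  have hres (v : (openKer χ₁).toSubgroup) : (c₁₂ - (Ψ : C1 p G)) v =
      -(K.κ (openKer χ₁) N : C1 p (openKer χ₁).toSubgroup) v := by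
    rw [hNf, map_add, K.res_comm (openKer χ₁) (openTop G) (le_openTop _)]
    change c₁₂ v - ((Φ : C1 p G) v + (K.κ (openTop G) f : C1 p (openTop G).toSubgroup) ⟨v, _⟩) =
      -(_ + (K.κ (openTop G) f : C1 p (openTop G).toSubgroup) ⟨v, _⟩)
    rw [hΦ]
    ring
  have hcup := cup_swap_mem_B2 ((cup_mem_B2_iff_exists_norm K (U := openKer χ₁ ⊓ openKer χ₃)
    (U' := openKer χ₁) (fun g hg => hg.1) (χ := pullH1 (incl _) χ₃)
    (fun g => ⟨fun hg => mem_openKer.1 hg.2, fun hg => ⟨g.2, mem_openKer.2 hg⟩⟩) _).2 ⟨z, rfl⟩)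
  refine zero_mem_massey_of_res K (c₁₂ := c₁₂ - (Ψ : C1 p G))
    (by rw [map_sub, LinearMap.mem_ker.1 Ψ.2, sub_zero, h₁₂]) h₂₃ ?_
  convert (B2 p (H1.ker χ₁)).neg_mem hcup using 1
  ext ⟨v, w⟩
  change (c₁₂ - (Ψ : C1 p G)) v * (χ₃ : C1 p G) w = -(_ * (χ₃ : C1 p G) w)
  rw [hres v, neg_mul]

end DefiningSystem

end KummerFormation

theorem theorem5p4 (p : ℕ) [Fact p.Prime]
    {G : Type*} [Group G] [TopologicalSpace G] [IsTopologicalGroup G] [CompactSpace G]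
    [TotallyDisconnectedSpace G]
    {A : Type*} [AddCommGroup A] [TopologicalSpace A] [DiscreteTopology A]
    [DistribMulAction G A] [ContinuousSMul G A]
    (K : PKummerFormation p G A) (χ₁ χ₂ χ₃ : KummerFormation.H1 p G) :
    ¬ KummerFormation.IsEssential (KummerFormation.massey χ₁ χ₂ χ₃) := by
  open KummerFormation in
  rintro ⟨⟨α, c₁₂, c₂₃, h₁₂, h₂₃, -⟩, h0⟩
  apply h0
  by_cases h3 : ∀ g, (χ₁ : C1 p G) g = 0 → (χ₃ : C1 p G) g = 0
  · -- `χ₃` is a multiple of `χ₁`, so vanishes on `Ker χ₁`.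
    refine zero_mem_massey_of_res K h₁₂ h₂₃ ?_
    convert (B2 p (H1.ker χ₁)).zero_mem using 1
    ext ⟨v, w⟩
    have : (χ₃ : C1 p G) w = 0 := h3 w (H1.mem_ker.1 w.2)
    simp [cup_apply, this]
  by_cases h1 : ∀ g, (χ₁ : C1 p G) g = 0
  · -- For `χ₁ = 0` one may take `c₁₂ = 0`.
    refine zero_mem_massey_of_res K (c₁₂ := 0) ?_ h₂₃ ?_
    · ext ⟨v, w⟩
      simp [cup_apply, h1]
    · convert (B2 p (H1.ker χ₁)).zero_mem using 1
      ext ⟨v, w⟩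
      simp [cup_apply]
  push Not at h1 h3
  obtain ⟨g, hg⟩ := h1
  obtain ⟨t, ht₁, ht₃⟩ := h3
  -- Powers normalize the values to `1`; then `σ` is corrected by a power of `τ`.
  have hscale (χ : H1 p G) (g : G) (hg : (χ : C1 p G) g ≠ 0) :
      (χ : C1 p G) (g ^ ((χ : C1 p G) g)⁻¹.val) = 1 := by
    rw [H1.map_pow, ZMod.natCast_zmod_val, inv_mul_cancel₀ hg]
  obtain ⟨τ, hτ₁, hτ₃⟩ : ∃ τ, (χ₁ : C1 p G) τ = 0 ∧ (χ₃ : C1 p G) τ = 1 :=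
    ⟨_, by rw [H1.map_pow, ht₁, mul_zero], hscale χ₃ t ht₃⟩
  obtain ⟨s, hs⟩ : ∃ s, (χ₁ : C1 p G) s = 1 := ⟨_, hscale χ₁ g hg⟩
  refine zero_mem_massey_of_dual K (σ := s * (τ ^ ((χ₃ : C1 p G) s).val)⁻¹) (τ := τ) ?_ ?_ hτ₁ hτ₃
    h₁₂ h₂₃
  · rw [H1.map_mul, H1.map_inv, H1.map_pow, hs, hτ₁, mul_zero, neg_zero, add_zero]
  · rw [H1.map_mul, H1.map_inv, H1.map_pow, hτ₃, ZMod.natCast_zmod_val, mul_one, add_neg_cancel]
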